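/- Let $M\ge 1$. For $\theta=(\alpha_1,a_1,b_1,\dots,\alpha_M,a_M,b_M)$ in $$\Theta=\Big\{\theta\in\mathbb R^{3M} : 0\le\alpha_m\le 1,\ \sum_{m=1}^M\alpha_m=1,\ b_m>0\ (m=1,\dots,M)\Big\}$$ let $f(x;\theta)=\sum_{m=1}^M\alpha_m\,\frac{1}{2b_m}\mathbf 1_{[a_m-b_m,\,a_m+b_m)}(x)$ be the corresponding mixture of $M$ uniform densities on half-open intervals. Let $\theta_0\in\Theta$ be such that $f(\cdot;\theta_0)$ is not equal to any mixture of fewer than $M$ uniform densities on half-open intervals, let $X_1,X_2,\dots$ be independent random variables with density $f(\cdot;\theta_0)$, and let $T_0=\{\theta\in\Theta : f(x;\theta)=f(x;\theta_0)\ \text{for all } x\}$ be the set of true parameters. Let $c_0>0$, $0<d<1$, $c_n=c_0\exp(-n^d)$ and $\Theta_n=\{\theta\in\Theta : b_m\ge c_n \text{ for all } m\}$. Then the maximum likelihood estimator restricted to $\Theta_n$ is strongly consistent: almost surely $$\lim_{n\to\infty}\ \inf_{\theta\in T_0}\|\hat\theta_n-\theta\|=0,$$ where $\|\cdot\|$ is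 the Euclidean norm. Since the supremum of the likelihood $L_n(\theta)=\prod_{i=1}^n f(X_i;\theta)$ over $\Theta_n$ need not be attained (the intervals being half-open), the maximum likelihood estimator is understood here in the following wide sense: for a fixed $\delta\in(0,1]$, $\hat\theta_n$ is any function of $X_1,\dots,X_n$ whose value is a parameter $\theta\in\Theta_n$ with $L_n(\theta)\ge\delta\,\sup_{\Theta_n}L_n$, or a limit of such parameters. This covers exact maximizers (where they exist), approximate maximizers, and limits of maximizing sequences. -/

import Mathlib

open MeasureTheory ProbabilityTheory Filter Topology

noncomputable section

namespace UniformMixture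

/-- The space `ℝ^(3M)` of the vectors `(α₁, a₁, b₁, …, α_M, a_M, b_M)`, with the Euclidean
distance. -/
abbrev Param (M : ℕ) : Type := EuclideanSpace ℝ (Fin M × Fin 3)

/-- The mixing weight `α_m`. -/
def weight {M : ℕ} (θ : Param M) (m : Fin M) : ℝ := θ (m, 0)

/-- The location parameter (midpoint) `a_m`. -/
def loc {M : ℕ} (θ : Param M) (m : Fin M) : ℝ := θ (m, 1)

/-- The scale parameter (half-length) `b_m`. -/
def scale {M : ℕ} (θ : Param M) (m : Fin M) : ℝ := θ (m, 2)

/-- The uniform density on the half-open interval `[a - b, a + b)`. -/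
def unifDensity (a b x : ℝ) : ℝ :=
  (Set.Ico (a - b) (a + b)).indicator (fun _ => 1 / (2 * b)) x

/-- The mixture density `f(x; θ) = ∑ α_m f_m(x; a_m, b_m)`. -/
def mixDensity {M : ℕ} (θ : Param M) (x : ℝ) : ℝ :=
  ∑ m : Fin M, weight θ m * unifDensity (loc θ m) (scale θ m) x

/-- The parameter space `Θ` of the mixtures with `M` components. -/
def paramSpace (M : ℕ) : Set (Param M) :=
  {θ | (∀ m, 0 ≤ weight θ m ∧ weight θ m ≤ 1) ∧ ∑ m, weight θ m = 1 ∧ ∀ m, 0 < scale θ m}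

/-- The restricted parameter space: all scale parameters are at least `c`. -/
def restrictedSpace (M : ℕ) (c : ℝ) : Set (Param M) :=
  {θ | θ ∈ paramSpace M ∧ ∀ m, c ≤ scale θ m}

/-- The set `T₀` of the true parameters. -/
def trueParams {M : ℕ} (θ₀ : Param M) : Set (Param M) :=
  {θ | θ ∈ paramSpace M ∧ ∀ x, mixDensity θ x = mixDensity θ₀ x}

/-- The density given by `θ₀` is not a mixture of fewer than `M` uniform densities. -/
def NotFewerComponents {M : ℕ} (θ₀ : Param M) : Prop :=
  ∀ k < M, ∀ θ ∈ paramSpace k, ∃ x, mixDensity θ x ≠ mixDensity θ₀ x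

/-- The likelihood of `θ` for the sample `x₁, …, x_n`. -/
def likelihood {M n : ℕ} (x : Fin n → ℝ) (θ : Param M) : ℝ :=
  ∏ i, mixDensity θ (x i)

/-- The parameters `θ` of the restricted space whose likelihood is at least `δ` times the supremum
of the likelihood over that space. For `δ = 1` these are the exact maximizers. Because the
intervals are half-open, the supremum need not be attained; for `0 < δ < 1` the set is nonempty. -/
def nearMaximizers {M n : ℕ} (c δ : ℝ) (x : Fin n → ℝ) : Set (Param M) :=
  {θ | θ ∈ restrictedSpace M c ∧
    ∀ θ' ∈ restrictedSpace M c, δ * likelihood x θ' ≤ likelihood x θ}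

/-- `est` (for each `n`, a function of a sample of size `n`) is a maximum likelihood estimator
restricted by `c n ≤ b_m`, up to the factor `δ`. Taking the closure also admits the limits of
maximizing sequences, such as the maximizers obtained with closed intervals. -/
def IsRestrictedMLE {M : ℕ} (c : ℕ → ℝ) (δ : ℝ)
    (est : (n : ℕ) → (Fin n → ℝ) → Param M) : Prop :=
  ∀ (n : ℕ) (x : Fin n → ℝ), est n x ∈ closure (nearMaximizers (c n) δ x)

/-- The law on `ℝ` with density `f(·; θ)`. -/
def mixLaw {M : ℕ} (θ : Param M) : Measure ℝ :=
  volume.withDensity fun x => ENNReal.ofReal (mixDensity θ x)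

end UniformMixture

end

open MeasureTheory ProbabilityTheory Filter Topology

namespace UniformMixture

lemma measurable_unifDensity (a b : ℝ) : Measurable (unifDensity a b) :=
  measurable_const.indicator measurableSet_Ico

lemma unifDensity_nonneg {a b : ℝ} (hb : 0 < b) (x : ℝ) : 0 ≤ unifDensity a b x :=
  Set.indicator_nonneg (fun _ _ => by positivity) x

lemma unifDensity_le {a b : ℝ} (hb : 0 < b) (x : ℝ) : unifDensity a b x ≤ 1 / (2 * b) :=
  Set.indicator_le_self' (fun _ _ => by positivity) x

lemma integrable_unifDensity (a b : ℝ) : Integrable (unifDensity a b) :=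
  (integrable_indicator_iff measurableSet_Ico).2 (integrableOn_const (by simp))

lemma setIntegral_unifDensity (a b : ℝ) (s : Set ℝ) :
    ∫ x in s, unifDensity a b x = volume.real (s ∩ Set.Ico (a - b) (a + b)) / (2 * b) := by
  unfold unifDensity
  rw [setIntegral_indicator measurableSet_Ico, setIntegral_const, smul_eq_mul, mul_one_div]

lemma integral_unifDensity (a : ℝ) {b : ℝ} (hb : 0 < b) : ∫ x, unifDensity a b x = 1 := by
  rw [← setIntegral_univ, setIntegral_unifDensity a b Set.univ, Set.univ_inter,
    Real.volume_real_Ico_of_le (by linarith)]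
  field_simp
  ring

section

variable {M : ℕ} {θ : Param M}

lemma measurable_mixDensity (θ : Param M) : Measurable (mixDensity θ) :=
  Finset.measurable_fun_sum _ fun _ _ => (measurable_unifDensity _ _).const_mul _

lemma integrable_mixDensity (θ : Param M) : Integrable (mixDensity θ) :=
  integrable_finsetSum _ fun _ _ => (integrable_unifDensity _ _).const_mul _

lemma component_nonneg (hθ : θ ∈ paramSpace M) (m : Fin M) (x : ℝ) :
    0 ≤ weight θ m * unifDensity (loc θ m) (scale θ m) x :=
  mul_nonneg (hθ.1 m).1 (unifDensity_nonneg (hθ.2.2 m) x)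

lemma mixDensity_nonneg (hθ : θ ∈ paramSpace M) (x : ℝ) : 0 ≤ mixDensity θ x :=
  Finset.sum_nonneg fun m _ => component_nonneg hθ m x

lemma component_le_mixDensity (hθ : θ ∈ paramSpace M) (m : Fin M) (x : ℝ) :
    weight θ m * unifDensity (loc θ m) (scale θ m) x ≤ mixDensity θ x :=
  Finset.single_le_sum (fun i _ => component_nonneg hθ i x) (Finset.mem_univ m)

lemma integral_mixDensity (hθ : θ ∈ paramSpace M) : ∫ x, mixDensity θ x = 1 := by
  unfold mixDensity
  rw [integral_finsetSum _ fun _ _ => (integrable_unifDensity _ _).const_mul _]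
  simp only [integral_const_mul, integral_unifDensity _ (hθ.2.2 _), mul_one]
  exact hθ.2.1

lemma setIntegral_mixDensity_le_one (hθ : θ ∈ paramSpace M) (s : Set ℝ) :
    ∫ x in s, mixDensity θ x ≤ 1 :=
  (setIntegral_le_integral (integrable_mixDensity θ)
    (ae_of_all _ (mixDensity_nonneg hθ))).trans_eq (integral_mixDensity hθ)

lemma exists_mixDensity_le (hθ : θ ∈ paramSpace M) : ∃ K, 0 < K ∧ ∀ x, mixDensity θ x ≤ K := by
  refine ⟨∑ m, weight θ m * (1 / (2 * scale θ m)) + 1, ?_, fun x => ?_⟩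
  · have : 0 ≤ ∑ m, weight θ m * (1 / (2 * scale θ m)) := Finset.sum_nonneg fun m _ =>
      mul_nonneg (hθ.1 m).1 (by have := hθ.2.2 m; positivity)
    linarith
  · refine (Finset.sum_le_sum fun m _ => mul_le_mul_of_nonneg_left
      (unifDensity_le (hθ.2.2 m) x) (hθ.1 m).1).trans (by linarith)

lemma exists_mixDensity_eq_zero (θ : Param M) :
    ∃ A, 0 < A ∧ ∀ x ∉ Set.Ico (-A) A, mixDensity θ x = 0 := by
  refine ⟨∑ m, (|loc θ m| + |scale θ m|) + 1, ?_, fun x hx => ?_⟩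
  · have : 0 ≤ ∑ m, (|loc θ m| + |scale θ m|) := Finset.sum_nonneg fun m _ => by positivity
    linarith
  · refine Finset.sum_eq_zero fun m _ => ?_
    rw [unifDensity, Set.indicator_of_notMem, mul_zero]
    intro h
    have h1 : |loc θ m| + |scale θ m| ≤ ∑ m, (|loc θ m| + |scale θ m|) :=
      Finset.single_le_sum (f := fun m => |loc θ m| + |scale θ m|)
        (fun i _ => by positivity) (Finset.mem_univ m)
    apply hx
    have := neg_abs_le (loc θ m)
    have := le_abs_self (loc θ m)
    have := neg_abs_le (scale θ m)
    have := le_abs_self (scale θ m)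
    constructor <;> linarith [h.1, h.2]

lemma setIntegral_mixDensity_eq_one (hθ : θ ∈ paramSpace M) {s : Set ℝ}
    (h0 : ∀ x ∉ s, mixDensity θ x = 0) : ∫ x in s, mixDensity θ x = 1 := by
  rw [setIntegral_eq_integral_of_forall_compl_eq_zero h0, integral_mixDensity hθ]

lemma setIntegral_compl_le {θ₀ : Param M} (hθ : θ ∈ paramSpace M) (hθ₀ : θ₀ ∈ paramSpace M)
    {s : Set ℝ} (hs : MeasurableSet s) (h0 : ∀ x ∉ s, mixDensity θ₀ x = 0) :
    ∫ x in sᶜ, mixDensity θ x ≤ ∫ x in s, |mixDensity θ x - mixDensity θ₀ x| := by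
  have h1 := integral_add_compl hs (integrable_mixDensity θ)
  rw [integral_mixDensity hθ, ← setIntegral_mixDensity_eq_one hθ₀ h0] at h1
  have h2 : ∫ x in s, (mixDensity θ₀ x - mixDensity θ x) ≤
      ∫ x in s, |mixDensity θ x - mixDensity θ₀ x| := by
    refine integral_mono
      ((integrable_mixDensity θ₀).integrableOn.sub (integrable_mixDensity θ).integrableOn)
      ((integrable_mixDensity θ).integrableOn.sub (integrable_mixDensity θ₀).integrableOn).abs
      fun x => ?_
    rw [abs_sub_comm]
    exact le_abs_self _
  rw [integral_sub (integrable_mixDensity θ₀).integrableOn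
    (integrable_mixDensity θ).integrableOn] at h2
  linarith

/-- Uniform densities on half-open intervals are right-continuous. -/
lemma continuousWithinAt_unifDensity (a b x : ℝ) :
    ContinuousWithinAt (unifDensity a b) (Set.Ioi x) x := by
  have key : ∀ᶠ y in 𝓝[>] x, unifDensity a b y = unifDensity a b x := by
    have hlt : ∀ c : ℝ, ∀ᶠ y in 𝓝[>] x, (y < c ↔ x < c) := by
      intro c
      rcases lt_or_ge x c with h | h
      · filter_upwards [mem_nhdsWithin_of_mem_nhds (Iio_mem_nhds h)] with y hy
        exact iff_of_true hy h
      · filter_upwards [self_mem_nhdsWithin] with y hy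
        exact iff_of_false (by simp only [Set.mem_Ioi] at hy; linarith) (by linarith)
    filter_upwards [hlt (a - b), hlt (a + b)] with y h1 h2
    simp only [unifDensity, Set.indicator_apply, Set.mem_Ico, h2, ← not_lt, h1]
  exact tendsto_const_nhds.congr' (key.mono fun _ h => h.symm)

lemma continuousWithinAt_mixDensity (θ : Param M) (x : ℝ) :
    ContinuousWithinAt (mixDensity θ) (Set.Ioi x) x :=
  tendsto_finsetSum _ fun _ _ => (continuousWithinAt_unifDensity _ _ x).const_mul _

lemma eq_of_ae_eq_of_continuousWithinAt_Ioi {f g : ℝ → ℝ} (h : f =ᵐ[volume] g)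
    (hf : ∀ x, ContinuousWithinAt f (Set.Ioi x) x)
    (hg : ∀ x, ContinuousWithinAt g (Set.Ioi x) x) : f = g := by
  funext x
  by_contra hne
  have h1 : ∀ᶠ y in 𝓝[>] x, f y - g y ≠ 0 :=
    ((hf x).sub (hg x)).eventually_ne (sub_ne_zero.2 hne)
  obtain ⟨u, hu, hsub⟩ := mem_nhdsGT_iff_exists_Ioo_subset.1 h1
  have h2 : volume (Set.Ioo x u) = 0 :=
    measure_mono_null (fun y hy => show y ∈ {y | ¬ f y = g y} from
      fun hfg => hsub hy (sub_eq_zero.2 hfg)) (ae_iff.1 h)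
  rw [Real.volume_Ioo, ENNReal.ofReal_eq_zero] at h2
  simp only [Set.mem_Ioi] at hu
  linarith

lemma tendsto_unifDensity {ι : Type*} {l : Filter ι} {a b : ι → ℝ} {a₀ b₀ x : ℝ}
    (ha : Tendsto a l (𝓝 a₀)) (hb : Tendsto b l (𝓝 b₀)) (hb₀ : b₀ ≠ 0)
    (h1 : x ≠ a₀ - b₀) (h2 : x ≠ a₀ + b₀) :
    Tendsto (fun k => unifDensity (a k) (b k) x) l (𝓝 (unifDensity a₀ b₀ x)) := by
  have hlt : ∀ {c : ι → ℝ} {c₀ : ℝ}, Tendsto c l (𝓝 c₀) → x ≠ c₀ →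
      ∀ᶠ k in l, (x < c k ↔ x < c₀) := by
    intro c c₀ hc hne
    rcases lt_or_gt_of_ne hne with h | h
    · filter_upwards [hc.eventually_const_lt h] with k hk
      exact iff_of_true hk h
    · filter_upwards [hc.eventually_lt_const h] with k hk
      exact iff_of_false (by linarith) (by linarith)
  have hlim : Tendsto (fun k => (Set.Ico (a₀ - b₀) (a₀ + b₀)).indicator
      (fun _ => 1 / (2 * b k)) x) l (𝓝 (unifDensity a₀ b₀ x)) := by
    unfold unifDensity
    by_cases hx : x ∈ Set.Ico (a₀ - b₀) (a₀ + b₀)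
    · simp only [Set.indicator_of_mem hx]
      exact tendsto_const_nhds.div (hb.const_mul 2) (by simpa using hb₀)
    · simp only [Set.indicator_of_notMem hx]
      exact tendsto_const_nhds
  refine hlim.congr' ?_
  filter_upwards [hlt (ha.sub hb) h1, hlt (ha.add hb) h2] with k hk1 hk2
  simp only [unifDensity, Set.indicator_apply, Set.mem_Ico, hk2, ← not_lt, hk1]

/-- A component of non-vanishing weight has bounded location and a scale bounded away from `0` and
`∞`, as long as the density is close to the true one. -/
lemma component_bounds {θ₀ : Param M} (hθ : θ ∈ paramSpace M) (hθ₀ : θ₀ ∈ paramSpace M)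
    {A K β : ℝ} (hA : 0 < A) (h0 : ∀ x ∉ Set.Ico (-A) A, mixDensity θ₀ x = 0)
    (hK : 0 < K) (hK' : ∀ x, mixDensity θ₀ x ≤ K) (hβ : 0 < β) {m : Fin M}
    (hm : β ≤ weight θ m)
    (hD : ∫ x in Set.Ico (-A) A, |mixDensity θ x - mixDensity θ₀ x| ≤ β / 4) :
    |loc θ m| ≤ 3 * A ∧ scale θ m ≤ 2 * A ∧ β / (4 * K) ≤ scale θ m := by
  set S := Set.Ico (-A) A with hS
  have hSm : MeasurableSet S := measurableSet_Ico
  set I := Set.Ico (loc θ m - scale θ m) (loc θ m + scale θ m) with hI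
  have hb := hθ.2.2 m
  set D := ∫ x in S, |mixDensity θ x - mixDensity θ₀ x| with hDdef
  have hU := integrable_unifDensity (loc θ m) (scale θ m)
  have h1 : weight θ m * ∫ x in Sᶜ, unifDensity (loc θ m) (scale θ m) x ≤ D := by
    rw [← integral_const_mul]
    exact (integral_mono (hU.const_mul _).integrableOn (integrable_mixDensity θ).integrableOn
      (component_le_mixDensity hθ m)).trans (setIntegral_compl_le hθ hθ₀ hSm h0)
  have h2 := integral_add_compl hSm hU
  rw [integral_unifDensity _ hb] at h2
  have h3 : 3 / 4 ≤ ∫ x in S, unifDensity (loc θ m) (scale θ m) x := by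
    have : ∫ x in Sᶜ, unifDensity (loc θ m) (scale θ m) x ≤ 1 / 4 := by
      by_contra! hlt
      nlinarith
    linarith
  have h4 := setIntegral_unifDensity (loc θ m) (scale θ m) S
  rw [h4, le_div_iff₀ (by positivity)] at h3
  have h5 : volume.real (S ∩ I) ≤ 2 * A := by
    refine (measureReal_mono Set.inter_subset_left (by simp [hS])).trans_eq ?_
    rw [hS, Real.volume_real_Ico_of_le (by linarith)]
    ring
  have h6 : volume.real (S ∩ I) ≤ 2 * scale θ m := by
    refine (measureReal_mono Set.inter_subset_right (by simp [hI])).trans_eq ?_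
    rw [hI, Real.volume_real_Ico_of_le (by linarith)]
    ring
  have hne : (S ∩ I).Nonempty := by
    by_contra hemp
    rw [Set.not_nonempty_iff_eq_empty] at hemp
    rw [← hI, hemp, measureReal_empty] at h3
    linarith
  obtain ⟨y, ⟨hy1, hy2⟩, hy3, hy4⟩ := hne
  have hb2 : scale θ m ≤ 2 * A := by linarith
  refine ⟨abs_le.2 ⟨by linarith, by linarith⟩, hb2, ?_⟩
  have h7 : weight θ m * ∫ x in S ∩ I, unifDensity (loc θ m) (scale θ m) x ≤
      D + K * volume.real (S ∩ I) := by
    rw [← integral_const_mul]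
    have hint : IntegrableOn (fun x => |mixDensity θ x - mixDensity θ₀ x|) (S ∩ I) :=
      ((integrable_mixDensity θ).sub (integrable_mixDensity θ₀)).abs.integrableOn
    have hcon : IntegrableOn (fun _ : ℝ => K) (S ∩ I) :=
      integrableOn_const (ne_top_of_le_ne_top (by simp [hS]) (measure_mono Set.inter_subset_left))
    calc _ ≤ ∫ x in S ∩ I, (|mixDensity θ x - mixDensity θ₀ x| + K) := by
          refine integral_mono (hU.const_mul _).integrableOn (hint.add hcon) fun x => ?_
          have := component_le_mixDensity hθ m x
          have := le_abs_self (mixDensity θ x - mixDensity θ₀ x)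
          have := hK' x
          linarith
      _ ≤ _ := by
          rw [integral_add hint hcon, setIntegral_const, smul_eq_mul, mul_comm K]
          gcongr
          exact setIntegral_mono_set
            ((integrable_mixDensity θ).sub (integrable_mixDensity θ₀)).abs.integrableOn
            (ae_of_all _ fun x => abs_nonneg _) Set.inter_subset_left.eventuallyLE
  have h8 := setIntegral_unifDensity (loc θ m) (scale θ m)
    (S ∩ I)
  rw [Set.inter_assoc, Set.inter_self] at h8
  rw [h8] at h7
  have h9 : 3 / 4 ≤ volume.real (S ∩ I) / (2 * scale θ m) :=
    (le_div_iff₀ (by positivity)).2 h3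
  have h10 : β * (3 / 4) ≤ weight θ m * (volume.real (S ∩ I) / (2 * scale θ m)) :=
    mul_le_mul hm h9 (by norm_num) (hβ.le.trans hm)
  rw [div_le_iff₀ (by positivity)]
  have := mul_le_mul_of_nonneg_left h6 hK.le
  linarith

lemma exists_fewer_components {M : ℕ} {θ : Param M} (hθ : θ ∈ paramSpace M) {m : Fin M}
    (hm : weight θ m = 0) : ∃ k < M, ∃ θ' ∈ paramSpace k, mixDensity θ' = mixDensity θ := by
  obtain _ | k := M
  · exact m.elim0
  have hsum := hθ.2.1
  rw [Fin.sum_univ_succAbove _ m, hm, zero_add] at hsum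
  refine ⟨k, k.lt_succ_self, WithLp.toLp 2 fun p => θ (m.succAbove p.1, p.2),
    ⟨fun i => hθ.1 _, hsum, fun i => hθ.2.2 _⟩, ?_⟩
  funext x
  rw [mixDensity, mixDensity, Fin.sum_univ_succAbove _ m, hm, zero_mul, zero_add]
  rfl

end

lemma mixDensity_mem_trueParams {M : ℕ} {θ θ₀ : Param M} (hθ : θ ∈ paramSpace M)
    (hθ₀ : θ₀ ∈ paramSpace M) {A : ℝ} (h0 : ∀ x ∉ Set.Ico (-A) A, mixDensity θ₀ x = 0)
    (hD : ∫ x in Set.Ico (-A) A, |mixDensity θ x - mixDensity θ₀ x| = 0) :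
    θ ∈ trueParams θ₀ := by
  set S := Set.Ico (-A) A
  have hSm : MeasurableSet S := measurableSet_Ico
  have hc : ∫ x in Sᶜ, mixDensity θ x = 0 :=
    le_antisymm ((setIntegral_compl_le hθ hθ₀ hSm h0).trans_eq hD)
      (integral_nonneg (mixDensity_nonneg hθ))
  rw [integral_eq_zero_iff_of_nonneg (fun x => mixDensity_nonneg hθ x)
    (integrable_mixDensity θ).integrableOn] at hc
  replace hD := (integral_eq_zero_iff_of_nonneg (fun x => abs_nonneg _)
    ((integrable_mixDensity θ).sub (integrable_mixDensity θ₀)).abs.integrableOn).1 hD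
  have hae : mixDensity θ =ᵐ[volume] mixDensity θ₀ := by
    filter_upwards [(ae_restrict_iff' hSm).1 hD, (ae_restrict_iff' hSm.compl).1 hc] with x h1 h2
    by_cases hx : x ∈ S
    · exact sub_eq_zero.1 (abs_eq_zero.1 (h1 hx))
    · rw [h0 x hx, h2 hx, Pi.zero_apply]
  exact ⟨hθ, congrFun (eq_of_ae_eq_of_continuousWithinAt_Ioi hae
    (continuousWithinAt_mixDensity θ) (continuousWithinAt_mixDensity θ₀))⟩

/-- The parameter `θ` with the components of weight zero replaced by the interval `[-1, 1)`. -/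
noncomputable def resetNull {M : ℕ} (θ : Param M) : Param M :=
  WithLp.toLp 2 fun p => if weight θ p.1 = 0 then ![0, 0, 1] p.2 else θ p

lemma infDist_trueParams_tendsto_zero {M : ℕ} {θ₀ : Param M} (hθ₀ : θ₀ ∈ paramSpace M)
    (hM : NotFewerComponents θ₀) {A : ℝ} (hA : 0 < A)
    (h0 : ∀ x ∉ Set.Ico (-A) A, mixDensity θ₀ x = 0) {θ : ℕ → Param M}
    (hθ : ∀ k, θ k ∈ paramSpace M)
    (hD : Tendsto (fun k => ∫ x in Set.Ico (-A) A, |mixDensity (θ k) x - mixDensity θ₀ x|)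
      atTop (𝓝 0)) :
    ∃ θ' ∈ trueParams θ₀, ∃ φ : ℕ → ℕ, StrictMono φ ∧ Tendsto (θ ∘ φ) atTop (𝓝 θ') := by
  set S := Set.Ico (-A) A with hS
  have hSm : MeasurableSet S := measurableSet_Ico
  obtain ⟨K, hK, hK'⟩ := exists_mixDensity_le hθ₀
  set R := max 1 (3 * A) with hR
  have hR1 : 1 ≤ R := le_max_left _ _
  have hR2 : 3 * A ≤ R := le_max_right _ _
  obtain ⟨v, hv, φ, hφ, hlim⟩ := (isCompact_Icc (a := fun _ : Fin M × Fin 3 => -R)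
    (b := fun _ => R)).tendsto_subseq (x := fun k p => max (-R) (min R (θ k p)))
    fun k => ⟨fun p => le_max_left _ _, fun p => max_le (by linarith) (min_le_left _ _)⟩
  have hlim' : ∀ p, Tendsto (fun k => max (-R) (min R (θ (φ k) p))) atTop (𝓝 (v p)) :=
    fun p => (tendsto_pi_nhds.1 hlim) p
  have hDφ := hD.comp hφ.tendsto_atTop
  have hw : ∀ m, Tendsto (fun k => weight (θ (φ k)) m) atTop (𝓝 (v (m, 0))) := fun m => by
    refine (hlim' (m, 0)).congr fun k => ?_
    have h := (hθ (φ k)).1 m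
    change 0 ≤ θ (φ k) (m, 0) ∧ θ (φ k) (m, 0) ≤ 1 at h
    rw [min_eq_right (by linarith), max_eq_right (by linarith)]
    rfl
  have hbd : ∀ m, 0 < v (m, 0) → ∀ᶠ k in atTop, |loc (θ (φ k)) m| ≤ 3 * A ∧
      scale (θ (φ k)) m ≤ 2 * A ∧ v (m, 0) / 2 / (4 * K) ≤ scale (θ (φ k)) m := fun m hm => by
    filter_upwards [(hw m).eventually_const_le (half_lt_self hm),
      hDφ.eventually_le_const (u := v (m, 0) / 2 / 4) (by positivity)] with k h1 h2
    exact component_bounds (hθ _) hθ₀ hA h0 hK hK' (by positivity) h1 h2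
  have hl : ∀ m, 0 < v (m, 0) → Tendsto (fun k => loc (θ (φ k)) m) atTop (𝓝 (v (m, 1))) :=
    fun m hm => by
      refine (hlim' (m, 1)).congr' ?_
      filter_upwards [hbd m hm] with k hk
      have := abs_le.1 hk.1
      change _ ≤ θ (φ k) (m, 1) ∧ θ (φ k) (m, 1) ≤ _ at this
      rw [min_eq_right (by linarith), max_eq_right (by linarith)]
      rfl
  have hs : ∀ m, 0 < v (m, 0) → Tendsto (fun k => scale (θ (φ k)) m) atTop (𝓝 (v (m, 2))) :=
    fun m hm => by
      refine (hlim' (m, 2)).congr' ?_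
      filter_upwards [hbd m hm] with k hk
      have h1 := hk.2.1
      have h2 := (hθ (φ k)).2.2 m
      change θ (φ k) (m, 2) ≤ _ at h1
      change 0 < θ (φ k) (m, 2) at h2
      rw [min_eq_right (by linarith), max_eq_right (by linarith)]
      rfl
  have hs0 : ∀ m, 0 < v (m, 0) → 0 < v (m, 2) := fun m hm =>
    lt_of_lt_of_le (by positivity) (ge_of_tendsto (hs m hm) ((hbd m hm).mono fun k hk => hk.2.2))
  have hv0 : ∀ m, 0 ≤ v (m, 0) := fun m =>
    ge_of_tendsto' (hw m) fun k => ((hθ (φ k)).1 m).1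
  have hv1 : ∀ m, v (m, 0) ≤ 1 := fun m =>
    le_of_tendsto' (hw m) fun k => ((hθ (φ k)).1 m).2
  have hvs : ∑ m, v (m, 0) = 1 := by
    refine tendsto_nhds_unique (tendsto_finsetSum _ fun m _ => hw m) ?_
    refine tendsto_const_nhds.congr fun k => ((hθ (φ k)).2.1).symm
  set θ' : Param M := resetNull (WithLp.toLp 2 v) with hθ'
  have hw' : ∀ m, weight θ' m = v (m, 0) := fun m => by
    by_cases hm : v (m, 0) = 0 <;> simp [hθ', weight, resetNull, hm]
  have hpos : ∀ m, v (m, 0) ≠ 0 → 0 < v (m, 0) := fun m hm => (hv0 m).lt_of_ne' hm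
  have hl' : ∀ m, v (m, 0) ≠ 0 → loc θ' m = v (m, 1) := fun m hm => by
    simp [hθ', loc, weight, resetNull, hm]
  have hs' : ∀ m, v (m, 0) ≠ 0 → scale θ' m = v (m, 2) := fun m hm => by
    simp [hθ', scale, weight, resetNull, hm]
  have hs'' : ∀ m, v (m, 0) = 0 → scale θ' m = 1 := fun m hm =>
    by
    simp [hθ', scale, weight, resetNull, hm]
  have hmem : θ' ∈ paramSpace M := by
    refine ⟨fun m => by rw [hw']; exact ⟨hv0 m, hv1 m⟩, by simpa only [hw'] using hvs, fun m => ?_⟩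
    by_cases hm : v (m, 0) = 0
    · rw [hs'' m hm]; exact one_pos
    · rw [hs' m hm]; exact hs0 m (hpos m hm)
  have hzero : ∫ x in S, |mixDensity θ' x - mixDensity θ₀ x| = 0 := by
    set G := Finset.univ.filter fun m => v (m, 0) ≠ 0 with hG
    set comp : Param M → Fin M → ℝ → ℝ := fun θ m x =>
      weight θ m * unifDensity (loc θ m) (scale θ m) x with hcomp
    have hci : ∀ θ m, Integrable (comp θ m) := fun θ m => (integrable_unifDensity _ _).const_mul _
    have hgi : ∀ θ, Integrable fun x => |∑ m ∈ G, comp θ m x - mixDensity θ₀ x| := fun θ =>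
      ((integrable_finsetSum _ fun m _ => hci θ m).sub (integrable_mixDensity θ₀)).abs
    have hdi : ∀ θ : Param M, Integrable fun x => |mixDensity θ x - mixDensity θ₀ x| := fun θ =>
      ((integrable_mixDensity θ).sub (integrable_mixDensity θ₀)).abs
    have hfull : ∀ x, mixDensity θ' x = ∑ m ∈ G, comp θ' m x := fun x => by
      refine (Finset.sum_subset (Finset.subset_univ G) fun m _ hm => ?_).symm
      have : v (m, 0) = 0 := by simpa [hG] using hm
      rw [hw', this, zero_mul]
    have hlim1 : Tendsto (fun k => ∫ x in S, |∑ m ∈ G, comp (θ (φ k)) m x - mixDensity θ₀ x|)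
        atTop (𝓝 (∫ x in S, |mixDensity θ' x - mixDensity θ₀ x|)) := by
      refine tendsto_integral_filter_of_dominated_convergence
        (fun _ => ∑ m ∈ G, 1 / (2 * (v (m, 0) / 2 / (4 * K))) + K)
        (Eventually.of_forall fun k => (hgi _).aestronglyMeasurable.restrict) ?_
        (integrableOn_const (by simp [hS])) ?_
      · have hev : ∀ᶠ k in atTop, ∀ m ∈ G, v (m, 0) / 2 / (4 * K) ≤ scale (θ (φ k)) m :=
          (Finset.eventually_all G).2 fun m hm =>
            (hbd m (hpos m (Finset.mem_filter.1 hm).2)).mono fun k hk => hk.2.2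
        filter_upwards [hev] with k hk
        refine ae_of_all _ fun x => ?_
        rw [Real.norm_eq_abs, abs_abs]
        refine (abs_sub _ _).trans (add_le_add ?_ ?_)
        · rw [abs_of_nonneg (Finset.sum_nonneg fun m _ => component_nonneg (hθ _) m x)]
          refine Finset.sum_le_sum fun m hm => ?_
          have := hpos m (Finset.mem_filter.1 hm).2
          calc comp (θ (φ k)) m x ≤ 1 * (1 / (2 * scale (θ (φ k)) m)) :=
                mul_le_mul ((hθ _).1 m).2 (unifDensity_le ((hθ _).2.2 m) x)
                  (unifDensity_nonneg ((hθ _).2.2 m) x) zero_le_one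
            _ ≤ _ := by
                rw [one_mul]
                exact one_div_le_one_div_of_le (by positivity)
                  (mul_le_mul_of_nonneg_left (hk m hm) (by norm_num))
        · rw [abs_of_nonneg (mixDensity_nonneg hθ₀ x)]
          exact hK' x
      · have hne : ∀ᵐ x ∂(volume.restrict S), ∀ m, x ≠ v (m, 1) - v (m, 2) ∧
            x ≠ v (m, 1) + v (m, 2) := by
          rw [ae_all_iff]
          exact fun m => ae_restrict_of_ae
            ((Measure.ae_ne volume _).and (Measure.ae_ne volume _))
        filter_upwards [hne] with x hx
        rw [hfull]
        refine ((tendsto_finsetSum _ fun m hm => ?_).sub_const _).abs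
        have hm := (Finset.mem_filter.1 hm).2
        have hm' := hpos m hm
        simp only [hcomp, hw', hl' m hm, hs' m hm]
        exact (hw m).mul (tendsto_unifDensity (hl m hm') (hs m hm') (hs0 m hm').ne'
          (hx m).1 (hx m).2)
    have hlim2 : Tendsto (fun k => (∫ x in S, |mixDensity (θ (φ k)) x - mixDensity θ₀ x|) +
        ∑ m ∈ Finset.univ \ G, weight (θ (φ k)) m) atTop (𝓝 0) := by
      have : Tendsto (fun k => ∑ m ∈ Finset.univ \ G, weight (θ (φ k)) m) atTop
          (𝓝 (∑ m ∈ Finset.univ \ G, v (m, 0))) := tendsto_finsetSum _ fun m _ => hw m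
      rw [Finset.sum_eq_zero fun m hm => by simpa [hG] using hm] at this
      simpa using hDφ.add this
    refine le_antisymm (le_of_tendsto_of_tendsto' hlim1 hlim2 fun k => ?_)
      (integral_nonneg fun x => abs_nonneg _)
    have hri : Integrable fun x => ∑ m ∈ Finset.univ \ G, comp (θ (φ k)) m x :=
      integrable_finsetSum _ fun m _ => hci _ m
    have hrest : ∫ x in S, ∑ m ∈ Finset.univ \ G, comp (θ (φ k)) m x ≤
        ∑ m ∈ Finset.univ \ G, weight (θ (φ k)) m := by
      refine (setIntegral_le_integral hri (ae_of_all _ fun x =>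
        Finset.sum_nonneg fun m _ => component_nonneg (hθ _) m x)).trans_eq ?_
      rw [integral_finsetSum _ fun m _ => hci _ m]
      simp only [hcomp, integral_const_mul, integral_unifDensity _ ((hθ _).2.2 _), mul_one]
    refine le_trans ?_ (add_le_add_right hrest _)
    rw [← integral_add (hdi _).integrableOn hri.integrableOn]
    refine integral_mono (hgi _).integrableOn ((hdi _).add hri).integrableOn fun x => ?_
    have hsplit : mixDensity (θ (φ k)) x = ∑ m ∈ Finset.univ \ G, comp (θ (φ k)) m x +
      ∑ m ∈ G, comp (θ (φ k)) m x := (Finset.sum_sdiff (Finset.subset_univ G)).symm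
    have hnn : 0 ≤ ∑ m ∈ Finset.univ \ G, comp (θ (φ k)) m x :=
      Finset.sum_nonneg fun m _ => component_nonneg (hθ _) m x
    simp only [hsplit]
    rw [abs_le]
    constructor
    · linarith [neg_abs_le (∑ m ∈ Finset.univ \ G, comp (θ (φ k)) m x +
        ∑ m ∈ G, comp (θ (φ k)) m x - mixDensity θ₀ x)]
    · linarith [le_abs_self (∑ m ∈ Finset.univ \ G, comp (θ (φ k)) m x +
        ∑ m ∈ G, comp (θ (φ k)) m x - mixDensity θ₀ x)]
  have htrue := mixDensity_mem_trueParams hmem hθ₀ h0 hzero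
  have hall : ∀ m, 0 < v (m, 0) := fun m => by
    refine hpos m fun hm => ?_
    obtain ⟨k, hk, θ'', hθ'', heq⟩ := exists_fewer_components hmem ((hw' m).trans hm)
    obtain ⟨x, hx⟩ := hM k hk θ'' hθ''
    exact hx (by rw [heq, htrue.2])
  refine ⟨θ', htrue, φ, hφ, ?_⟩
  have : Tendsto (fun k => WithLp.ofLp (θ (φ k))) atTop (𝓝 (WithLp.ofLp θ')) := by
    rw [tendsto_pi_nhds]
    rintro ⟨m, i⟩
    fin_cases i
    · have h := hw m
      rw [← hw' m] at h
      exact h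
    · have h := hl m (hall m)
      rw [← hl' m (hall m).ne'] at h
      exact h
    · have h := hs m (hall m)
      rw [← hs' m (hall m).ne'] at h
      exact h
  exact ((PiLp.continuous_toLp 2 _).tendsto _).comp this

lemma exists_separation {M : ℕ} {θ₀ : Param M} (hθ₀ : θ₀ ∈ paramSpace M)
    (hM : NotFewerComponents θ₀) {A : ℝ} (hA : 0 < A)
    (h0 : ∀ x ∉ Set.Ico (-A) A, mixDensity θ₀ x = 0) {ε : ℝ} (hε : 0 < ε) :
    ∃ ρ > 0, ∀ θ ∈ paramSpace M, ε ≤ Metric.infDist θ (trueParams θ₀) →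
      ρ ≤ ∫ x in Set.Ico (-A) A, |mixDensity θ x - mixDensity θ₀ x| := by
  by_contra! hcon
  choose θ hθ hdist hD using fun k : ℕ => hcon (1 / ((k : ℝ) + 1)) (by positivity)
  obtain ⟨θ', hθ', φ, -, hlim⟩ := infDist_trueParams_tendsto_zero hθ₀ hM hA h0 hθ
    (squeeze_zero (fun k => integral_nonneg fun x => abs_nonneg _) (fun k => (hD k).le)
      tendsto_one_div_add_atTop_nhds_zero_nat)
  have h1 := ((Metric.continuous_infDist_pt (trueParams θ₀)).tendsto θ').comp hlim
  rw [Metric.infDist_zero_of_mem hθ'] at h1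
  exact absurd (ge_of_tendsto' h1 fun k => hdist (φ k)) (by linarith)

lemma sqrt_mul_le_sub_abs {u g : ℝ} (hu : 0 ≤ u) (hg : 0 ≤ g) (t : ℝ) :
    √(u * g) ≤ (1 / 2 + t ^ 2) * (u + g) - t * |u - g| := by
  rw [Real.sqrt_mul hu]
  have h1 := Real.sq_sqrt hu
  have h2 := Real.sq_sqrt hg
  set a := √u
  set b := √g
  have ha : 0 ≤ a := Real.sqrt_nonneg u
  have hb : 0 ≤ b := Real.sqrt_nonneg g
  have h3 : |u - g| = |a - b| * (a + b) := by
    rw [← h1, ← h2, sq_sub_sq, abs_mul, abs_of_nonneg (add_nonneg ha hb), mul_comm]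
  rw [h3, ← h1, ← h2]
  have h4 := sq_abs (a - b)
  nlinarith [sq_nonneg (|a - b| - t * (a + b)), mul_nonneg (sq_nonneg t) (sq_nonneg (a - b))]

/-- The Hellinger affinity of `g` and an upper bracket `u` of `f`, when `f` is far from `g`. -/
lemma setLIntegral_sqrt_mul_le {S : Set ℝ} (hS : MeasurableSet S) {u f g : ℝ → ℝ}
    (hu : IntegrableOn u S) (hf : IntegrableOn f S) (hg : IntegrableOn g S)
    (hu0 : ∀ x, 0 ≤ u x) (hg0 : ∀ x, 0 ≤ g x) (hfu : ∀ x ∈ S, f x ≤ u x) {s ρ t : ℝ}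
    (hf1 : ∫ x in S, f x ≤ 1) (hg1 : ∫ x in S, g x ≤ 1)
    (hfu1 : ∫ x in S, u x ≤ (∫ x in S, f x) + s)
    (hρ : ρ ≤ ∫ x in S, |f x - g x|) (ht : 0 ≤ t) :
    ∫⁻ x in S, ENNReal.ofReal √(u x * g x) ≤
      ENNReal.ofReal ((1 / 2 + t ^ 2) * (2 + s) - t * (ρ - s)) := by
  have hi : IntegrableOn (fun x => (1 / 2 + t ^ 2) * (u x + g x) - t * |u x - g x|) S :=
    ((hu.add hg).const_mul _).sub ((hu.sub hg).abs.const_mul _)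
  calc ∫⁻ x in S, ENNReal.ofReal √(u x * g x)
      ≤ ∫⁻ x in S, ENNReal.ofReal ((1 / 2 + t ^ 2) * (u x + g x) - t * |u x - g x|) :=
        lintegral_mono fun x => ENNReal.ofReal_le_ofReal (sqrt_mul_le_sub_abs (hu0 x) (hg0 x) t)
    _ = ENNReal.ofReal (∫ x in S, ((1 / 2 + t ^ 2) * (u x + g x) - t * |u x - g x|)) :=
        (ofReal_integral_eq_lintegral_ofReal hi (ae_of_all _ fun x =>
          (Real.sqrt_nonneg _).trans (sqrt_mul_le_sub_abs (hu0 x) (hg0 x) t))).symm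
    _ ≤ _ := by
        refine ENNReal.ofReal_le_ofReal ?_
        have h1 : ∫ x in S, |f x - g x| ≤ ∫ x in S, (|u x - g x| + (u x - f x)) := by
          refine setIntegral_mono_on (hf.sub hg).abs ((hu.sub hg).abs.add (hu.sub hf)) hS
            fun x hx => ?_
          have h2 := hfu x hx
          have h3 := abs_sub_le (f x) (u x) (g x)
          rw [abs_sub_comm (f x) (u x), abs_of_nonneg (sub_nonneg.2 h2)] at h3
          linarith
        have h2 : ∫ x in S, (|u x - g x| + (u x - f x)) =
            (∫ x in S, |u x - g x|) + ((∫ x in S, u x) - ∫ x in S, f x) := by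
          rw [← integral_sub hu hf]
          exact integral_add (hu.sub hg).abs (hu.sub hf)
        have h3 : ∫ x in S, ((1 / 2 + t ^ 2) * (u x + g x) - t * |u x - g x|) =
            (1 / 2 + t ^ 2) * ((∫ x in S, u x) + ∫ x in S, g x) - t * ∫ x in S, |u x - g x| := by
          rw [← integral_add hu hg, ← integral_const_mul, ← integral_const_mul]
          exact integral_sub ((hu.add hg).const_mul _) ((hu.sub hg).abs.const_mul _)
        rw [h3]
        have h4 : (1 / 2 + t ^ 2) * ((∫ x in S, u x) + ∫ x in S, g x) ≤
            (1 / 2 + t ^ 2) * (2 + s) := mul_le_mul_of_nonneg_left (by linarith) (by positivity)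
        have h5 : t * (ρ - s) ≤ t * ∫ x in S, |u x - g x| :=
          mul_le_mul_of_nonneg_left (by linarith) ht
        linarith

/-- A step function on `[-A, A)` with heights in `κ ℕ` and breakpoints on a grid of `N` cells. -/
noncomputable def bracket {M N : ℕ} (A κ : ℝ) (q : Fin M × Fin 3 → Fin (N + 1)) (x : ℝ) : ℝ :=
  ∑ m, (Set.Ico (-A + 2 * A / N * (q (m, 1) : ℕ)) (-A + 2 * A / N * (q (m, 2) : ℕ))).indicator
    (fun _ => κ * (q (m, 0) : ℕ)) x

lemma measurable_bracket {M N : ℕ} (A κ : ℝ) (q : Fin M × Fin 3 → Fin (N + 1)) :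
    Measurable (bracket A κ q) :=
  Finset.measurable_fun_sum _ fun _ _ => measurable_const.indicator measurableSet_Ico

lemma integrable_bracket {M N : ℕ} (A κ : ℝ) (q : Fin M × Fin 3 → Fin (N + 1)) :
    Integrable (bracket A κ q) :=
  integrable_finsetSum _ fun _ _ =>
    (integrable_indicator_iff measurableSet_Ico).2 (integrableOn_const (by simp))

lemma bracket_nonneg {M N : ℕ} (A : ℝ) {κ : ℝ} (hκ : 0 ≤ κ) (q : Fin M × Fin 3 → Fin (N + 1))
    (x : ℝ) : 0 ≤ bracket A κ q x :=
  Finset.sum_nonneg fun _ _ => Set.indicator_nonneg (fun _ _ => by positivity) x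

lemma exists_bracket_component {A κ c : ℝ} (hA : 0 < A) (hκ : 0 < κ) (hc : 0 < c) {N : ℕ}
    (hN0 : 0 < N) (hN1 : 2 * A / N ≤ c * κ) (hN2 : 1 / (2 * c) ≤ κ * N) {w a b : ℝ}
    (hw0 : 0 ≤ w) (hw1 : w ≤ 1) (hb : c ≤ b) :
    ∃ i j k : Fin (N + 1),
      (∀ x ∈ Set.Ico (-A) A, w * unifDensity a b x ≤
        (Set.Ico (-A + 2 * A / N * (i : ℕ)) (-A + 2 * A / N * (j : ℕ))).indicator
          (fun _ => κ * (k : ℕ)) x) ∧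
      ∫ x in Set.Ico (-A) A,
        (Set.Ico (-A + 2 * A / N * (i : ℕ)) (-A + 2 * A / N * (j : ℕ))).indicator
          (fun _ => κ * (k : ℕ)) x ≤
        (∫ x in Set.Ico (-A) A, w * unifDensity a b x) + κ * (6 * A + 1) := by
  have hNpos : (0 : ℝ) < N := Nat.cast_pos.2 hN0
  set τ := 2 * A / N with hτ
  have hτ0 : 0 < τ := by positivity
  have hτN : τ * N = 2 * A := by rw [hτ]; field_simp
  have hτA : τ ≤ 2 * A := by
    rw [← hτN]
    exact le_mul_of_one_le_right hτ0.le (by exact_mod_cast hN0)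
  set h := w * (1 / (2 * b)) with hh
  have hb0 : 0 < b := hc.trans_le hb
  have hh0 : 0 ≤ h := by positivity
  have hhc : h ≤ 1 / (2 * c) := by
    calc h ≤ 1 * (1 / (2 * b)) := mul_le_mul_of_nonneg_right hw1 (by positivity)
      _ ≤ 1 / (2 * c) := by rw [one_mul]; gcongr
  set l := max (-A) (min A (a - b)) with hl
  set r := max (-A) (min A (a + b)) with hr
  have hl1 : -A ≤ l := le_max_left _ _
  have hl2 : l ≤ A := max_le (by linarith) (min_le_left _ _)
  have hr1 : -A ≤ r := le_max_left _ _
  have hr2 : r ≤ A := max_le (by linarith) (min_le_left _ _)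
  have hlr : l ≤ r := max_le_max le_rfl (min_le_min le_rfl (by linarith))
  have hI : Set.Ico (-A) A ∩ Set.Ico (a - b) (a + b) = Set.Ico l r := by
    ext x
    simp only [Set.mem_inter_iff, Set.mem_Ico, hl, hr, max_le_iff, min_le_iff, lt_max_iff,
      lt_min_iff]
    constructor
    · rintro ⟨⟨h1, h2⟩, h3, h4⟩
      exact ⟨⟨h1, Or.inr h3⟩, Or.inr ⟨h2, h4⟩⟩
    · rintro ⟨⟨h1, h2⟩, h3⟩
      have h3 := h3.resolve_left (by linarith)
      exact ⟨⟨h1, h3.1⟩, h2.resolve_left (by linarith [h3.1]), h3.2⟩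
  have hi : ⌊(l + A) / τ⌋₊ ≤ N := Nat.floor_le_of_le (by rw [div_le_iff₀ hτ0]; linarith)
  have hj : ⌈(r + A) / τ⌉₊ ≤ N := Nat.ceil_le.2 (by rw [div_le_iff₀ hτ0]; linarith)
  have hk : ⌈h / κ⌉₊ ≤ N := Nat.ceil_le.2 (by rw [div_le_iff₀ hκ]; linarith)
  have hi1 : τ * ⌊(l + A) / τ⌋₊ ≤ l + A := by
    rw [mul_comm, ← le_div_iff₀ hτ0]
    exact Nat.floor_le (div_nonneg (by linarith) hτ0.le)
  have hi2 : l + A ≤ τ * ⌊(l + A) / τ⌋₊ + τ := by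
    have := (Nat.lt_floor_add_one ((l + A) / τ)).le
    rw [div_le_iff₀ hτ0] at this
    linarith
  have hj1 : r + A ≤ τ * ⌈(r + A) / τ⌉₊ := by
    rw [mul_comm, ← div_le_iff₀ hτ0]
    exact Nat.le_ceil _
  have hj2 : τ * ⌈(r + A) / τ⌉₊ ≤ r + A + τ := by
    have := (Nat.ceil_lt_add_one (div_nonneg (by linarith) hτ0.le : 0 ≤ (r + A) / τ)).le
    rw [← sub_le_iff_le_add, le_div_iff₀ hτ0] at this
    linarith
  have hk1 : h ≤ κ * ⌈h / κ⌉₊ := by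
    rw [mul_comm, ← div_le_iff₀ hκ]
    exact Nat.le_ceil _
  have hk2 : κ * ⌈h / κ⌉₊ ≤ h + κ := by
    have := (Nat.ceil_lt_add_one (div_nonneg hh0 hκ.le)).le
    rw [← sub_le_iff_le_add, le_div_iff₀ hκ] at this
    linarith
  refine ⟨⟨_, Nat.lt_succ_of_le hi⟩, ⟨_, Nat.lt_succ_of_le hj⟩, ⟨_, Nat.lt_succ_of_le hk⟩, ?_, ?_⟩
  · intro x hx
    simp only
    by_cases hxI : x ∈ Set.Ico (a - b) (a + b)
    · have hx' : x ∈ Set.Ico l r := hI ▸ ⟨hx, hxI⟩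
      rw [unifDensity, Set.indicator_of_mem hxI, Set.indicator_of_mem]
      · exact hk1
      · exact ⟨by linarith [hx'.1], by linarith [hx'.2]⟩
    · rw [unifDensity, Set.indicator_of_notMem hxI, mul_zero]
      exact Set.indicator_nonneg (fun _ _ => by positivity) x
  · simp only
    have hwh : w * ((r - l) / (2 * b)) = h * (r - l) := by rw [hh]; ring
    rw [integral_const_mul, setIntegral_unifDensity, hI, Real.volume_real_Ico_of_le hlr, hwh,
      setIntegral_indicator measurableSet_Ico, setIntegral_const, smul_eq_mul]
    have hvol : volume.real (Set.Ico (-A) A ∩ Set.Ico (-A + τ * ⌊(l + A) / τ⌋₊)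
        (-A + τ * ⌈(r + A) / τ⌉₊)) ≤ r - l + 2 * τ := by
      refine (measureReal_mono Set.inter_subset_right (by simp)).trans ?_
      rw [Real.volume_real_Ico_of_le (by linarith)]
      linarith
    have hhτ : 2 * (h * τ) ≤ κ := by
      calc 2 * (h * τ) ≤ 2 * (1 / (2 * c) * (c * κ)) := by gcongr
        _ = κ := by field_simp
    calc _ ≤ (r - l + 2 * τ) * (h + κ) :=
          mul_le_mul hvol hk2 (by positivity) (by linarith)
      _ = h * (r - l) + 2 * (h * τ) + κ * (r - l) + κ * (2 * τ) := by ring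
      _ ≤ h * (r - l) + κ + κ * (2 * A) + κ * (2 * (2 * A)) := by
          gcongr
          linarith
      _ = _ := by ring

lemma exists_bracket {A κ c : ℝ} (hA : 0 < A) (hκ : 0 < κ) (hc : 0 < c) {M N : ℕ}
    (hN0 : 0 < N) (hN1 : 2 * A / N ≤ c * κ) (hN2 : 1 / (2 * c) ≤ κ * N) {θ : Param M}
    (hθ : θ ∈ restrictedSpace M c) :
    ∃ q : Fin M × Fin 3 → Fin (N + 1),
      (∀ x ∈ Set.Ico (-A) A, mixDensity θ x ≤ bracket A κ q x) ∧
      ∫ x in Set.Ico (-A) A, bracket A κ q x ≤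
        (∫ x in Set.Ico (-A) A, mixDensity θ x) + M * (κ * (6 * A + 1)) := by
  choose i j k h1 h2 using fun m => exists_bracket_component hA hκ hc hN0 hN1 hN2
    (a := loc θ m) (hθ.1.1 m).1 (hθ.1.1 m).2 (hθ.2 m)
  refine ⟨fun p => ![k p.1, i p.1, j p.1] p.2,
    fun x hx => Finset.sum_le_sum fun m _ => h1 m x hx, ?_⟩
  unfold bracket mixDensity
  have hint : ∀ (l r w : ℝ) (s : Set ℝ),
      Integrable ((Set.Ico l r).indicator fun _ => w) (volume.restrict s) := fun l r w s =>
    ((integrable_indicator_iff measurableSet_Ico).2 (integrableOn_const (by simp))).integrableOn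
  rw [integral_finsetSum _ fun m _ => hint _ _ _ _,
    integral_finsetSum _ fun m _ => ((integrable_unifDensity _ _).const_mul _).integrableOn]
  refine (Finset.sum_le_sum fun m _ => h2 m).trans_eq ?_
  rw [Finset.sum_add_distrib, Finset.sum_const, Finset.card_univ, Fintype.card_fin, nsmul_eq_mul]

lemma lintegral_prod_eq_prod_lintegral_of_iIndepFun {Ω ι : Type*} [MeasurableSpace Ω]
    [Fintype ι] {P : Measure Ω} {Z : ι → Ω → ENNReal} (hZ : iIndepFun Z P)
    (hm : ∀ i, AEMeasurable (Z i) P) :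
    ∫⁻ ω, ∏ i, Z i ω ∂P = ∏ i, ∫⁻ ω, Z i ω ∂P := by
  have hall : ∀ᵐ ω ∂P, ∀ i, Z i ω = (hm i).mk _ ω := ae_all_iff.2 fun i => (hm i).ae_eq_mk
  rw [lintegral_congr_ae (hall.mono fun ω h => Finset.prod_congr rfl fun i _ => h i),
    lintegral_prod_eq_prod_lintegral_of_indepFun _ _ (hZ.congr fun i => (hm i).ae_eq_mk)
      fun i => (hm i).measurable_mk]
  exact Finset.prod_congr rfl fun i _ => (lintegral_congr_ae (hm i).ae_eq_mk).symm

section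

variable {Ω : Type*} [MeasurableSpace Ω] {P : Measure Ω} {M : ℕ} {θ₀ : Param M} {X : ℕ → Ω → ℝ}

lemma ae_mixDensity_pos (hθ₀ : θ₀ ∈ paramSpace M) (hlaw : ∀ i, HasLaw (X i) (mixLaw θ₀) P) :
    ∀ᵐ ω ∂P, ∀ i, 0 < mixDensity θ₀ (X i ω) := by
  have hms : MeasurableSet {x | 0 < mixDensity θ₀ x} :=
    measurableSet_lt measurable_const (measurable_mixDensity θ₀)
  refine ae_all_iff.2 fun i => ?_
  have h : ∀ᵐ x ∂(mixLaw θ₀), 0 < mixDensity θ₀ x := by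
    rw [mixLaw, ae_withDensity_iff (measurable_mixDensity θ₀).ennreal_ofReal]
    exact ae_of_all _ fun x hx =>
      (mixDensity_nonneg hθ₀ x).lt_of_ne' fun h0 => hx (by rw [h0, ENNReal.ofReal_zero])
  rw [← (hlaw i).map_eq] at h
  exact ae_of_ae_map (hlaw i).aemeasurable h

lemma measure_likelihood_ratio_le (hθ₀ : θ₀ ∈ paramSpace M) (hindep : iIndepFun X P)
    (hlaw : ∀ i, HasLaw (X i) (mixLaw θ₀) P) {u : ℝ → ℝ} (hu : Measurable u)
    {δ q : ℝ} (hδ : 0 < δ) (hu0 : ∀ x, 0 ≤ u x)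
    (hq : ∫⁻ x, ENNReal.ofReal √(u x * mixDensity θ₀ x) ≤ ENNReal.ofReal q) (hq0 : 0 ≤ q)
    (n : ℕ) :
    P {ω | δ * ∏ i : Fin n, mixDensity θ₀ (X i ω) ≤ ∏ i : Fin n, u (X i ω)} ≤
      ENNReal.ofReal (q ^ n / √δ) := by
  set φ : ℝ → ENNReal := fun x => ENNReal.ofReal √(u x / mixDensity θ₀ x) with hφ
  have hφm : Measurable φ := (hu.div (measurable_mixDensity θ₀)).sqrt.ennreal_ofReal
  have hφi : ∫⁻ x, φ x ∂(mixLaw θ₀) ≤ ENNReal.ofReal q := by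
    refine le_trans (le_of_eq ?_) hq
    rw [mixLaw, lintegral_withDensity_eq_lintegral_mul _
      (measurable_mixDensity θ₀).ennreal_ofReal hφm]
    refine lintegral_congr fun x => ?_
    have hx := mixDensity_nonneg hθ₀ x
    rw [Pi.mul_apply, hφ, ← ENNReal.ofReal_mul hx]
    congr 1
    nth_rewrite 1 [← Real.sqrt_sq hx]
    rw [← Real.sqrt_mul (sq_nonneg _)]
    congr 1
    rcases eq_or_ne (mixDensity θ₀ x) 0 with h | h
    · simp [h]
    · field_simp
  set Z : Fin n → Ω → ENNReal := fun i ω => φ (X i ω) with hZ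
  have hZm : ∀ i, AEMeasurable (Z i) P := fun i => hφm.comp_aemeasurable (hlaw i).aemeasurable
  have hZind : iIndepFun Z P :=
    (hindep.precomp Fin.val_injective).comp (fun _ => φ) fun _ => hφm
  have hE : ∫⁻ ω, ∏ i, Z i ω ∂P ≤ ENNReal.ofReal (q ^ n) := by
    rw [lintegral_prod_eq_prod_lintegral_of_iIndepFun hZind hZm, ENNReal.ofReal_pow hq0]
    refine (Finset.prod_le_pow_card _ _ (ENNReal.ofReal q) fun i _ => ?_).trans_eq (by simp)
    exact ((hlaw i).lintegral_comp hφm.aemeasurable).trans_le hφi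
  have hsub : P {ω | δ * ∏ i : Fin n, mixDensity θ₀ (X i ω) ≤ ∏ i : Fin n, u (X i ω)} ≤
      P {ω | ENNReal.ofReal √δ ≤ ∏ i, Z i ω} := by
    refine measure_mono_ae ?_
    filter_upwards [ae_mixDensity_pos hθ₀ hlaw] with ω hω h
    change ENNReal.ofReal √δ ≤ ∏ i, Z i ω
    change δ * ∏ i : Fin n, mixDensity θ₀ (X i ω) ≤ ∏ i : Fin n, u (X i ω) at h
    rw [← le_div_iff₀ (Finset.prod_pos fun (i : Fin n) _ => hω i), ← Finset.prod_div_distrib] at h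
    simp only [hZ, hφ]
    rw [← ENNReal.ofReal_prod_of_nonneg fun i _ => Real.sqrt_nonneg _,
      ← Real.sqrt_prod _ fun (i : Fin n) _ => div_nonneg (hu0 _) (hω i).le]
    exact ENNReal.ofReal_le_ofReal (Real.sqrt_le_sqrt h)
  have hδ' : 0 < √δ := Real.sqrt_pos.2 hδ
  rw [ENNReal.ofReal_div_of_pos hδ', ENNReal.le_div_iff_mul_le
    (Or.inl (ENNReal.ofReal_pos.2 hδ').ne') (Or.inl ENNReal.ofReal_ne_top), mul_comm]
  refine (mul_le_mul_right hsub _).trans ((mul_meas_ge_le_lintegral₀ ?_ _).trans hE)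
  exact Finset.aemeasurable_fun_prod _ fun i _ => hZm i

lemma summable_exp_rpow_sub {d η : ℝ} (hd : d < 1) (hη : 0 < η) (C : ℝ) :
    Summable fun n : ℕ => Real.exp (C * (n : ℝ) ^ d - η * n) := by
  have hlit : (fun n : ℕ => C * (n : ℝ) ^ d) =o[atTop] fun n : ℕ => (n : ℝ) := by
    refine (Asymptotics.isLittleO_of_tendsto' ?_ ?_).const_mul_left C
    · filter_upwards [eventually_gt_atTop 0] with n hn h
      exact absurd h (Nat.cast_pos.2 hn).ne'
    · refine ((tendsto_rpow_neg_atTop (sub_pos.2 hd)).comp tendsto_natCast_atTop_atTop).congr' ?_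
      filter_upwards [eventually_gt_atTop 0] with n hn
      rw [Function.comp_apply, neg_sub, Real.rpow_sub_one (Nat.cast_pos.2 hn).ne']
  refine summable_of_isBigO_nat (Real.summable_exp_nat_mul_iff.2 (show -(η / 2) < 0 by linarith))
    (Asymptotics.IsBigO.of_bound 1 ?_)
  filter_upwards [hlit.bound (half_pos hη)] with n hn
  rw [Real.norm_eq_abs, Real.norm_eq_abs, Nat.abs_cast] at hn
  rw [Real.norm_eq_abs, Real.norm_eq_abs, Real.abs_exp, Real.abs_exp, one_mul, Real.exp_le_exp]
  have := le_abs_self (C * (n : ℝ) ^ d)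
  linarith

end

section

variable {M : ℕ} {θ₀ : Param M}

/-- Parameters far from the true ones admit brackets whose Hellinger affinity with the true density
is bounded away from one. -/
lemma exists_bracket_affinity_le (hθ₀ : θ₀ ∈ paramSpace M) (hM : NotFewerComponents θ₀) {A : ℝ}
    (hA : 0 < A) (h0 : ∀ x ∉ Set.Ico (-A) A, mixDensity θ₀ x = 0) {ε : ℝ} (hε : 0 < ε) :
    ∃ η > 0, ∃ κ > 0, ∀ c > 0, ∀ N : ℕ, 0 < N → 2 * A / N ≤ c * κ → 1 / (2 * c) ≤ κ * N →
      ∀ θ ∈ restrictedSpace M c, ε ≤ Metric.infDist θ (trueParams θ₀) →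
        ∃ q : Fin M × Fin 3 → Fin (N + 1),
          (∀ x ∈ Set.Ico (-A) A, mixDensity θ x ≤ bracket A κ q x) ∧
          ∫⁻ x, ENNReal.ofReal √(bracket A κ q x * mixDensity θ₀ x) ≤
            ENNReal.ofReal (Real.exp (-η)) := by
  obtain ⟨ρ, hρ, hsep⟩ := exists_separation hθ₀ hM hA h0 hε
  set t := ρ / 4 with ht
  have ht0 : 0 < t := by positivity
  set s := ρ ^ 2 / 16 / (1 / 2 + t ^ 2 + t) with hs
  have hs0 : 0 < s := by positivity
  have hs' : s * (1 / 2 + t ^ 2 + t) = ρ ^ 2 / 16 := by rw [hs]; field_simp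
  refine ⟨ρ ^ 2 / 16, by positivity, s / ((M + 1) * (6 * A + 1)), by positivity,
    fun c hc N hN0 hN1 hN2 θ hθ hfar => ?_⟩
  set κ := s / ((M + 1) * (6 * A + 1)) with hκ
  have hκ0 : 0 < κ := by positivity
  obtain ⟨q, hq1, hq2⟩ := exists_bracket hA hκ0 hc hN0 hN1 hN2 hθ
  refine ⟨q, hq1, ?_⟩
  have hMs : M * (κ * (6 * A + 1)) ≤ s := by
    have : s = (M + 1) * (κ * (6 * A + 1)) := by rw [hκ]; field_simp
    rw [this]
    gcongr
    linarith
  have hset : ∫⁻ x, ENNReal.ofReal √(bracket A κ q x * mixDensity θ₀ x) =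
      ∫⁻ x in Set.Ico (-A) A, ENNReal.ofReal √(bracket A κ q x * mixDensity θ₀ x) := by
    rw [← lintegral_indicator measurableSet_Ico]
    refine lintegral_congr fun x => ?_
    by_cases hx : x ∈ Set.Ico (-A) A
    · rw [Set.indicator_of_mem hx]
    · rw [Set.indicator_of_notMem hx, h0 x hx, mul_zero, Real.sqrt_zero, ENNReal.ofReal_zero]
  rw [hset]
  refine (setLIntegral_sqrt_mul_le measurableSet_Ico (integrable_bracket A κ q).integrableOn
    (integrable_mixDensity θ).integrableOn (integrable_mixDensity θ₀).integrableOn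
    (bracket_nonneg A hκ0.le q) (mixDensity_nonneg hθ₀) hq1
    (setIntegral_mixDensity_le_one hθ.1 _) (setIntegral_mixDensity_le_one hθ₀ _)
    (hq2.trans (add_le_add_right hMs _)) (hsep θ hθ.1 hfar) ht0.le).trans
    (ENNReal.ofReal_le_ofReal ?_)
  calc (1 / 2 + t ^ 2) * (2 + s) - t * (ρ - s)
      = 1 + 2 * t ^ 2 - t * ρ + s * (1 / 2 + t ^ 2 + t) := by ring
    _ = -(ρ ^ 2 / 16) + 1 := by rw [hs', ht]; ring
    _ ≤ _ := Real.add_one_le_exp _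

variable {Ω : Type*} [MeasurableSpace Ω] {P : Measure Ω} {X : ℕ → Ω → ℝ}

lemma measure_exists_far_le (hθ₀ : θ₀ ∈ paramSpace M) (hM : NotFewerComponents θ₀)
    (hindep : iIndepFun X P) (hlaw : ∀ i, HasLaw (X i) (mixLaw θ₀) P)
    {δ : ℝ} (hδ : 0 < δ) {ε : ℝ} (hε : 0 < ε) :
    ∃ η > 0, ∃ C > 0, ∀ c > 0, ∀ n : ℕ,
      P {ω | ∃ θ ∈ restrictedSpace M c, ε ≤ Metric.infDist θ (trueParams θ₀) ∧
        δ * likelihood (fun i : Fin n => X i ω) θ₀ ≤ likelihood (fun i : Fin n => X i ω) θ} ≤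
      ENNReal.ofReal ((C / c + 2) ^ (M * 3) * (Real.exp (-η) ^ n / √δ)) := by
  obtain ⟨A, hA, h0⟩ := exists_mixDensity_eq_zero θ₀
  obtain ⟨η, hη, κ, hκ, hbr⟩ := exists_bracket_affinity_le hθ₀ hM hA h0 hε
  refine ⟨η, hη, (2 * A + 1) / κ, by positivity, fun c hc n => ?_⟩
  set C := (2 * A + 1) / κ with hC
  have hC0 : 0 < C := by positivity
  set N := ⌈C / c⌉₊ with hN
  have hN0 : 0 < N := Nat.ceil_pos.2 (by positivity)
  have hN' : (0 : ℝ) < N := Nat.cast_pos.2 hN0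
  have hCN : 2 * A + 1 ≤ N * (c * κ) := by
    have h1 : C / c ≤ N := Nat.le_ceil _
    rw [hC, div_div, div_le_iff₀ (by positivity)] at h1
    linarith
  have hN1 : 2 * A / N ≤ c * κ := by
    rw [div_le_iff₀ hN']
    linarith
  have hN2 : 1 / (2 * c) ≤ κ * N := by
    rw [div_le_iff₀ (by positivity)]
    linarith
  set Q := {q : Fin M × Fin 3 → Fin (N + 1) |
    ∫⁻ x, ENNReal.ofReal √(bracket A κ q x * mixDensity θ₀ x) ≤
      ENNReal.ofReal (Real.exp (-η))} with hQ
  set E : (Fin M × Fin 3 → Fin (N + 1)) → Set Ω := fun q =>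
    {ω | δ * ∏ i : Fin n, mixDensity θ₀ (X i ω) ≤ ∏ i : Fin n, bracket A κ q (X i ω)} with hE
  set r : ℝ := Real.exp (-η) ^ n / √δ with hr
  have hr0 : 0 ≤ r := by positivity
  have hcover : P {ω | ∃ θ ∈ restrictedSpace M c, ε ≤ Metric.infDist θ (trueParams θ₀) ∧
      δ * likelihood (fun i : Fin n => X i ω) θ₀ ≤ likelihood (fun i : Fin n => X i ω) θ} ≤
      P (⋃ q : Q, E q) := by
    refine measure_mono_ae ?_
    filter_upwards [ae_mixDensity_pos hθ₀ hlaw] with ω hω h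
    obtain ⟨θ, hθ, hfar, hL⟩ := h
    obtain ⟨q, hq1, hq2⟩ := hbr c hc N hN0 hN1 hN2 θ hθ hfar
    refine Set.mem_iUnion.2 ⟨⟨q, hq2⟩, hL.trans ?_⟩
    refine Finset.prod_le_prod (fun i _ => mixDensity_nonneg hθ.1 _) fun i _ => hq1 _ ?_
    by_contra hx
    exact (hω i).ne' (h0 _ hx)
  refine hcover.trans ((measure_iUnion_fintype_le P _).trans ?_)
  calc ∑ q : Q, P (E q) ≤ ∑ q : Q, ENNReal.ofReal r :=
        Finset.sum_le_sum fun q _ => measure_likelihood_ratio_le hθ₀ hindep hlaw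
          (measurable_bracket A κ _) hδ (bracket_nonneg A hκ.le _) q.2 (Real.exp_pos _).le n
    _ = ENNReal.ofReal (Fintype.card Q * r) := by
        rw [Finset.sum_const, nsmul_eq_mul, Finset.card_univ,
          ENNReal.ofReal_mul (Nat.cast_nonneg _), ENNReal.ofReal_natCast]
    _ ≤ _ := by
        refine ENNReal.ofReal_le_ofReal (mul_le_mul_of_nonneg_right ?_ hr0)
        have h1 : Fintype.card Q ≤ (N + 1) ^ (M * 3) :=
          (Fintype.card_subtype_le _).trans_eq (by simp)
        have h2 : (N : ℝ) + 1 ≤ C / c + 2 := by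
          have := (Nat.ceil_lt_add_one (show 0 ≤ C / c by positivity)).le
          linarith
        calc (Fintype.card Q : ℝ) ≤ ((N : ℝ) + 1) ^ (M * 3) := by exact_mod_cast h1
          _ ≤ _ := by gcongr

lemma ae_eventually_infDist_lt (hθ₀ : θ₀ ∈ paramSpace M) (hM : NotFewerComponents θ₀)
    (hindep : iIndepFun X P) (hlaw : ∀ i, HasLaw (X i) (mixLaw θ₀) P)
    {c₀ d : ℝ} (hc₀ : 0 < c₀) (hd₁ : d < 1) {δ : ℝ} (hδ : 0 < δ) {ε : ℝ} (hε : 0 < ε) :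
    ∀ᵐ ω ∂P, ∀ᶠ n : ℕ in atTop, ∀ θ ∈ restrictedSpace M (c₀ * Real.exp (-(n : ℝ) ^ d)),
      δ * likelihood (fun i : Fin n => X i ω) θ₀ ≤ likelihood (fun i : Fin n => X i ω) θ →
      Metric.infDist θ (trueParams θ₀) < ε := by
  obtain ⟨η, hη, C, hC, hP⟩ := measure_exists_far_le hθ₀ hM hindep hlaw hδ hε
  have hsum : Summable fun n : ℕ =>
      (C / (c₀ * Real.exp (-(n : ℝ) ^ d)) + 2) ^ (M * 3) * (Real.exp (-η) ^ n / √δ) := by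
    refine ((summable_exp_rpow_sub hd₁ hη (M * 3 : ℕ)).mul_left
      ((C / c₀ + 2) ^ (M * 3) / √δ)).of_nonneg_of_le (fun n => by positivity) fun n => ?_
    have h1 : C / (c₀ * Real.exp (-(n : ℝ) ^ d)) + 2 ≤ (C / c₀ + 2) * Real.exp ((n : ℝ) ^ d) := by
      have h2 : 1 ≤ Real.exp ((n : ℝ) ^ d) := Real.one_le_exp (by positivity)
      rw [Real.exp_neg, ← div_div, div_inv_eq_mul]
      linarith
    calc (C / (c₀ * Real.exp (-(n : ℝ) ^ d)) + 2) ^ (M * 3) * (Real.exp (-η) ^ n / √δ)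
        ≤ ((C / c₀ + 2) * Real.exp ((n : ℝ) ^ d)) ^ (M * 3) * (Real.exp (-η) ^ n / √δ) := by
          gcongr
      _ = _ := by
          rw [mul_pow, ← Real.exp_nat_mul, ← Real.exp_nat_mul, sub_eq_add_neg, Real.exp_add,
            show (n : ℝ) * -η = -(η * n) by ring]
          ring
  filter_upwards [ae_eventually_notMem (ne_top_of_le_ne_top hsum.tsum_ofReal_ne_top
    (ENNReal.tsum_le_tsum fun n : ℕ => hP (c₀ * Real.exp (-(n : ℝ) ^ d)) (by positivity) n))]
    with ω hω
  filter_upwards [hω] with n hn θ hθ hL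
  by_contra! hfar
  exact hn ⟨θ, hθ, hfar, hL⟩

lemma eventually_mem_restrictedSpace (hθ₀ : θ₀ ∈ paramSpace M) {c : ℕ → ℝ}
    (hc : Tendsto c atTop (𝓝 0)) : ∀ᶠ n in atTop, θ₀ ∈ restrictedSpace M (c n) := by
  filter_upwards [eventually_all.2 fun m => hc.eventually_le_const (hθ₀.2.2 m)] with n hn
  exact ⟨hθ₀, hn⟩

end

end UniformMixture

open UniformMixture

theorem theorem1 {Ω : Type*} [MeasurableSpace Ω] (P : Measure Ω) [IsProbabilityMeasure P]
    (M : ℕ) (θ₀ : UniformMixture.Param M) (hθ₀ : θ₀ ∈ UniformMixture.paramSpace M)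
    (hM : UniformMixture.NotFewerComponents θ₀)
    (X : ℕ → Ω → ℝ) (hindep : iIndepFun X P)
    (hlaw : ∀ i, HasLaw (X i) (UniformMixture.mixLaw θ₀) P)
    (c₀ d : ℝ) (hc₀ : 0 < c₀) (hd₀ : 0 < d) (hd₁ : d < 1)
    (δ : ℝ) (hδ₀ : 0 < δ) (hδ₁ : δ ≤ 1)
    (est : (n : ℕ) → (Fin n → ℝ) → UniformMixture.Param M)
    (hest : UniformMixture.IsRestrictedMLE
      (fun n => c₀ * Real.exp (-(n : ℝ) ^ d)) δ est) :
    ∀ᵐ ω ∂P, Tendsto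
      (fun n : ℕ => Metric.infDist (est n fun i : Fin n => X i ω)
        (UniformMixture.trueParams θ₀))
      atTop (𝓝 0) := by
  have hc : Tendsto (fun n : ℕ => c₀ * Real.exp (-(n : ℝ) ^ d)) atTop (𝓝 0) := by
    simpa using (Real.tendsto_exp_neg_atTop_nhds_zero.comp
      ((tendsto_rpow_atTop hd₀).comp tendsto_natCast_atTop_atTop)).const_mul c₀
  filter_upwards [ae_all_iff.2 fun j : ℕ => ae_eventually_infDist_lt hθ₀ hM hindep hlaw hc₀ hd₁
    hδ₀ (show (0 : ℝ) < 1 / ((j : ℝ) + 1) by positivity)] with ω hω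
  refine Metric.tendsto_atTop'.2 fun e he => ?_
  obtain ⟨j, hj⟩ := exists_nat_one_div_lt he
  obtain ⟨n₀, hn₀⟩ := eventually_atTop.1 ((hω j).and (eventually_mem_restrictedSpace hθ₀ hc))
  refine ⟨n₀, fun n hn => ?_⟩
  obtain ⟨h1, h2⟩ := hn₀ n hn.le
  rw [Real.dist_0_eq_abs, abs_of_nonneg Metric.infDist_nonneg]
  refine lt_of_le_of_lt ?_ hj
  refine closure_minimal (fun θ hθ => ?_)
    (isClosed_le (Metric.continuous_infDist_pt (trueParams θ₀)) continuous_const)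
    (hest n fun i : Fin n => X i ω)
  exact (h1 θ hθ.1 (hθ.2 θ₀ h2)).le
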